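/- Let $L\ge 1$ and $n_L>n_{L-1}>\dots>n_0\ge 1$. Let $A_L\in\mathbb R^{n_L\times n_L}$ be symmetric positive definite. For $k=1,\dots,L$ let $P_k\in\mathbb R^{n_k\times n_{k-1}}$ have rank $n_{k-1}$, put $A_{k-1}:=P_k^TA_kP_k$, and let $M_k\in\mathbb R^{n_k\times n_k}$ be nonsingular with $M_k+M_k^T-A_k$ symmetric positive definite. Put $\widetilde M_k:=M_k^T(M_k+M_k^T-A_k)^{-1}M_k$. Let $\|v\|_{A}=\langle Av,v\rangle^{1/2}$ and $\|B\|_A=\max_{v\ne0}\|Bv\|_A/\|v\|_A$, and let $\lambda(\cdot)$, $\lambda_{\min}(\cdot)$, $\lambda_{\max}(\cdot)$ denote the spectrum, the smallest and the largest eigenvalue. The exact two-grid convergence factor at level $k$ is $\sigma_{TG}^{(k)}:=\|E_{TG}^{(k)}\|_{A_k}$ with $$E_{TG}^{(k)}=(I-M_k^{-T}A_k)(I-P_kA_{k-1}^{-1}P_k^TA_k)(I-M_k^{-1}A_k).$$ For a cycle index $\gamma\ge1$ and a matrix $\hat A_0\in\mathbb R^{n_0\times n_0}$ with $\hat A_0-A_0$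 symmetric positive semidefinite, the inexact multigrid convergence factor at level $k$ is $\sigma_{IMG}^{(k)}:=\|E_{IMG}^{(k)}\|_{A_k}$, where $$E_{IMG}^{(k)}=(I-M_k^{-T}A_k)(I-P_kS_{k-1}P_k^TA_k)(I-M_k^{-1}A_k)\quad(1\le k\le L)$$ is the iteration matrix of the multigrid method, with $S_0=\hat A_0^{-1}$ and $S_{k}=\big(I-(E_{IMG}^{(k)})^\gamma\big)A_{k}^{-1}$ for $1\le k<L$. Set $$\sigma_L:=\max_{1\le k\le L}\sigma_{TG}^{(k)},\quad \tau_L:=\max_{1\le k\le L}\lambda_{\max}\big((P_k^T\widetilde M_kP_k)^{-1}A_{k-1}\big),\quad \varepsilon_L:=\min_{1\le k\le L}\lambda_{\min}(\widetilde M_k^{-1}A_k),$$ and assume $0<\sigma_L<1-\varepsilon_L$. For $\gamma\ge1$ consider the equation $$\frac{\sigma_L\varepsilon_L(1-x^\gamma)+\tau_L(1-\varepsilon_L)(1-\sigma_L)x^\gamma}{\varepsilon_L(1-x^\gamma)+\tau_L(1-\sigma_L)x^\gamma}-x=0.\qquad(*)$$ Then there is a strictly decreasing sequence $(x_\gamma)_{\gamma\ge1}\subset(\sigma_L,1-\varepsilon_L)$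 with limit $\sigma_L$ such that $x_\gamma$ solves $(*)$ for every $\gamma\ge1$. Moreover, let $\gamma\ge1$, let $x_\gamma\in(\sigma_L,1-\varepsilon_L)$ be any root of $(*)$, and let $\hat A_0$ be such that $\hat A_0-A_0$ is symmetric positive semidefinite. If $$\lambda\big((P_1^T\widetilde M_1P_1)^{-1}(\hat A_0-A_0)\big)\subset\left[0,\ \frac{\varepsilon_L(x_\gamma-\sigma_L)}{(1-\sigma_L)(1-\varepsilon_L-x_\gamma)}\right],$$ then $\sigma_{IMG}^{(k)}\le x_\gamma$ for all $k=1,\dots,L$. -/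

import Mathlib

open Matrix

noncomputable section

namespace Multigrid

/-- The largest (real) eigenvalue of a square matrix. -/
def lamMax {m : Type*} [Fintype m] [DecidableEq m] (B : Matrix m m ℝ) : ℝ :=
  sSup (spectrum ℝ B)

/-- The smallest (real) eigenvalue of a square matrix. -/
def lamMin {m : Type*} [Fintype m] [DecidableEq m] (B : Matrix m m ℝ) : ℝ :=
  sInf (spectrum ℝ B)

/-- The energy norm `‖v‖_A = ⟨A v, v⟩^(1/2)` of a vector. -/
def energyNorm {m : Type*} [Fintype m] (A : Matrix m m ℝ) (v : m → ℝ) : ℝ :=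
  Real.sqrt ((A *ᵥ v) ⬝ᵥ v)

/-- The energy norm `‖B‖_A = max_{v ≠ 0} ‖B v‖_A / ‖v‖_A` of a matrix. -/
def energyOpNorm {m : Type*} [Fintype m] (A B : Matrix m m ℝ) : ℝ :=
  sSup {r : ℝ | ∃ v : m → ℝ, v ≠ 0 ∧ r = energyNorm A (B *ᵥ v) / energyNorm A v}

/-- The symmetrized smoother `Mᵀ (M + Mᵀ - A)⁻¹ M`. -/
def symmSmoother {m : Type*} [Fintype m] [DecidableEq m] (A M : Matrix m m ℝ) :
    Matrix m m ℝ :=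
  Mᵀ * (M + Mᵀ - A)⁻¹ * M

/-- The iteration matrix `(I - M⁻ᵀ A) (I - P S Pᵀ A) (I - M⁻¹ A)` of a symmetric two-grid scheme
in which the coarse system with residual `r` is solved (approximately) by `S r`. -/
def twoGridIter {m c : Type*} [Fintype m] [DecidableEq m] [Fintype c]
    (A M : Matrix m m ℝ) (P : Matrix m c ℝ) (S : Matrix c c ℝ) : Matrix m m ℝ :=
  (1 - (Mᵀ)⁻¹ * A) * (1 - P * S * Pᵀ * A) * (1 - M⁻¹ * A)

/-- The data of a multigrid method with levels `0` (coarsest), ..., `L` (finest).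
`P k` is the prolongation from level `k` to level `k + 1`, `M k` the smoother at level `k`
(used for `1 ≤ k ≤ L`), `A L` the given matrix, and the other `A k` are the Galerkin coarse-grid
matrices. Entries beyond level `L` are irrelevant. -/
structure Hierarchy (L : ℕ) where
  /-- number of unknowns at each level -/
  n : ℕ → ℕ
  A : ∀ k, Matrix (Fin (n k)) (Fin (n k)) ℝ
  M : ∀ k, Matrix (Fin (n k)) (Fin (n k)) ℝ
  P : ∀ k, Matrix (Fin (n (k + 1))) (Fin (n k)) ℝ
  n_zero_pos : 0 < n 0
  n_lt : ∀ k < L, n k < n (k + 1)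
  posDef : (A L).PosDef
  rank_P : ∀ k < L, (P k).rank = n k
  galerkin : ∀ k < L, A k = (P k)ᵀ * A (k + 1) * P k
  isUnit_M : ∀ k < L, IsUnit (M (k + 1))
  smoother : ∀ k < L, (M (k + 1) + (M (k + 1))ᵀ - A (k + 1)).PosDef

namespace Hierarchy

variable {L : ℕ} (H : Hierarchy L)

/-- The symmetrized smoother at level `k`. -/
def Mtilde (k : ℕ) : Matrix (Fin (H.n k)) (Fin (H.n k)) ℝ :=
  symmSmoother (H.A k) (H.M k)

/-- The restriction to level `k` of the symmetrized smoother at level `k + 1`. -/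
def restrictedSmoother (k : ℕ) : Matrix (Fin (H.n k)) (Fin (H.n k)) ℝ :=
  (H.P k)ᵀ * H.Mtilde (k + 1) * H.P k

/-- The iteration matrix of the exact two-grid method at level `k + 1`. -/
def ETG (k : ℕ) : Matrix (Fin (H.n (k + 1))) (Fin (H.n (k + 1))) ℝ :=
  twoGridIter (H.A (k + 1)) (H.M (k + 1)) (H.P k) ((H.P k)ᵀ * H.A (k + 1) * H.P k)⁻¹

/-- The convergence factor of the exact two-grid method at level `k + 1`. -/
def sigmaTG (k : ℕ) : ℝ := energyOpNorm (H.A (k + 1)) (H.ETG k)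

/-- The approximate solution operator that the multigrid method with cycle index `γ` applies to
the residual at level `k` when this level serves as a coarse level: `Â₀⁻¹` at level `0`, and
`(I - E ^ γ) A⁻¹`, that is `γ` multigrid iterations with zero initial guess, at higher levels. -/
def coarseSolve (Ahat : Matrix (Fin (H.n 0)) (Fin (H.n 0)) ℝ) (γ : ℕ) :
    (k : ℕ) → Matrix (Fin (H.n k)) (Fin (H.n k)) ℝ
  | 0 => Ahat⁻¹
  | k + 1 =>
    (1 - (twoGridIter (H.A (k + 1)) (H.M (k + 1)) (H.P k) (coarseSolve Ahat γ k)) ^ γ) *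
      (H.A (k + 1))⁻¹

/-- The iteration matrix of the inexact multigrid method at level `k + 1`. -/
def EIMG (Ahat : Matrix (Fin (H.n 0)) (Fin (H.n 0)) ℝ) (γ k : ℕ) :
    Matrix (Fin (H.n (k + 1))) (Fin (H.n (k + 1))) ℝ :=
  twoGridIter (H.A (k + 1)) (H.M (k + 1)) (H.P k) (H.coarseSolve Ahat γ k)

/-- The convergence factor of the inexact multigrid method at level `k + 1`. -/
def sigmaIMG (Ahat : Matrix (Fin (H.n 0)) (Fin (H.n 0)) ℝ) (γ k : ℕ) : ℝ :=
  energyOpNorm (H.A (k + 1)) (H.EIMG Ahat γ k)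

/-- The maximum over the levels `1, ..., L` of the exact two-grid convergence factors. -/
def sigmaL : ℝ := ⨆ k : Fin L, H.sigmaTG k

/-- The maximum over `1 ≤ k ≤ L` of `λ_max((P_kᵀ M̃_k P_k)⁻¹ A_{k-1})`. -/
def tauL : ℝ := ⨆ k : Fin L, lamMax ((H.restrictedSmoother k)⁻¹ * H.A k)

/-- The minimum over `1 ≤ k ≤ L` of `λ_min(M̃_k⁻¹ A_k)`. -/
def epsL : ℝ := ⨅ k : Fin L, lamMin ((H.Mtilde (k + 1))⁻¹ * H.A (k + 1))

end Hierarchy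

/-- The function `F_γ` whose root defines the multigrid bound. -/
def rootFun (σ τ ε : ℝ) (γ : ℕ) (x : ℝ) : ℝ :=
  (σ * ε * (1 - x ^ γ) + τ * (1 - ε) * (1 - σ) * x ^ γ) /
    (ε * (1 - x ^ γ) + τ * (1 - σ) * x ^ γ) - x

end Multigrid

end

/-!
The proof works with quadratic forms in place of spectra; inequalities between iteration matrices
are meant in the inner product of the matrix `A` of their level. For a two-grid step with coarse
solver `S` one has `A E = A - A (N + R P S Pᵀ Rᵀ) A`, where `R = 1 - M⁻ᵀ A` is post-smoothing and
`N = M⁻ᵀ (M + Mᵀ - A) M⁻¹` (`smoothInv`), see `twoGridIter_form_eq_sub`. By Fenchel-Young, a lower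
bound for the preconditioner `N + R P S Pᵀ Rᵀ` amounts to writing each `v` as `w + R P y` with
small energy `⟨N⁻¹ w, w⟩ + ⟨S⁻¹ y, y⟩`. The exact step (`S = Ac⁻¹`) with convergence factor `σ`
has such a splitting of energy at most `⟨A v, v⟩ / (1 - σ)` (`exists_splitting`), while `v = v +
0` has energy at most `⟨A v, v⟩ / ε`.

If `S` is only bounded below by `(Ac + δ Pᵀ M̃ P)⁻¹` (`IsApproxInv`), the average of these two
splittings with weights `1 / (1 + δ)` and `δ / (1 + δ)` is used. The extra energy `δ ⟨M̃ P y, P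
y⟩` is then compensated exactly, by the identity `Rᵀ N⁻¹ R = M̃ - A` (`postSmooth_form`), and the
energy of the average is at most the average of the energies. This gives the two-grid bound `E ≤
x` with `δ (1 - σ) (1 - ε - x) = ε (x - σ)` (`twoGridIter_form_le`).

Conversely, from `0 ≤ E ≤ x` the coarse solver `(1 - E ^ γ) A⁻¹` of the next level is bounded
below by `(1 - x ^ γ) A⁻¹ ≥ (A + δ' X)⁻¹`, `X` being the restriction of the next symmetrized
smoother and `δ' = τ x ^ γ / (1 - x ^ γ)` (`isApproxInv_iterate`). The equation for `x` says
precisely that `δ' = δ`, so `δ` and the bound `x` propagate from the coarsest level to the finest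
(`Hierarchy.sigmaIMG_le`). The extreme eigenvalues enter only through the Rayleigh quotient
(`exists_mem_spectrum_form_le`), and the statements about the roots follow from the intermediate
value theorem (`exists_root_sequence`).
-/

namespace Multigrid

/-! ### Quadratic forms of real symmetric matrices -/

theorem _root_.Matrix.PosSemidef.transpose_eq {m : Type*} {A : Matrix m m ℝ}
    (hA : A.PosSemidef) : Aᵀ = A := by
  simpa using hA.isHermitian.eq

theorem _root_.Matrix.PosDef.transpose_eq {m : Type*} {A : Matrix m m ℝ} (hA : A.PosDef) :
    Aᵀ = A :=
  hA.posSemidef.transpose_eq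

section QuadraticForms

variable {m c : Type*} [Fintype m] [Fintype c]

theorem mulVec_dotProduct_eq (B : Matrix m c ℝ) (x : c → ℝ) (y : m → ℝ) :
    (B *ᵥ x) ⬝ᵥ y = x ⬝ᵥ (Bᵀ *ᵥ y) := by
  rw [dotProduct_mulVec, vecMul_transpose]

theorem dotProduct_mulVec_comm_of_symm {A : Matrix m m ℝ} (hA : Aᵀ = A) (x y : m → ℝ) :
    x ⬝ᵥ (A *ᵥ y) = y ⬝ᵥ (A *ᵥ x) := by
  rw [dotProduct_comm, mulVec_dotProduct_eq, hA]

theorem _root_.Matrix.PosSemidef.form_nonneg {A : Matrix m m ℝ} (hA : A.PosSemidef) (v : m → ℝ) :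
    0 ≤ v ⬝ᵥ (A *ᵥ v) := by
  simpa using hA.dotProduct_mulVec_nonneg v

theorem _root_.Matrix.PosDef.form_pos {A : Matrix m m ℝ} (hA : A.PosDef) {v : m → ℝ}
    (hv : v ≠ 0) : 0 < v ⬝ᵥ (A *ᵥ v) := by
  simpa using hA.dotProduct_mulVec_pos hv

/-- Expansion of `0 ≤ ⟨A (x - y), x - y⟩`; it replaces the Cauchy-Schwarz inequality throughout. -/
theorem two_mul_form_sub_le {A : Matrix m m ℝ} (hA : A.PosSemidef) (x y : m → ℝ) :
    2 * (x ⬝ᵥ (A *ᵥ y)) - y ⬝ᵥ (A *ᵥ y) ≤ x ⬝ᵥ (A *ᵥ x) := by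
  have h := hA.form_nonneg (x - y)
  have hc := dotProduct_mulVec_comm_of_symm hA.transpose_eq x y
  simp only [mulVec_sub, dotProduct_sub, sub_dotProduct] at h
  linarith

/-- The hypothesis `A R = Tᵀ A` says that `R` and `T` are adjoint to each other in the inner product
of `A`; they have the same norm, so that a bound for `R` is a bound for `T`. -/
theorem form_adjoint_le {A R T : Matrix m m ℝ} (hA : A.PosDef) (hRT : A * R = Tᵀ * A) {c : ℝ}
    (hc : 0 < c)
    (h : ∀ v, (R *ᵥ v) ⬝ᵥ (A *ᵥ (R *ᵥ v)) ≤ c * (v ⬝ᵥ (A *ᵥ v))) (v : m → ℝ) :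
    (T *ᵥ v) ⬝ᵥ (A *ᵥ (T *ᵥ v)) ≤ c * (v ⬝ᵥ (A *ᵥ v)) := by
  have h1 := h (T *ᵥ v)
  have h2 := two_mul_form_sub_le hA.posSemidef v (c⁻¹ • (R *ᵥ (T *ᵥ v)))
  have h3 : v ⬝ᵥ (A *ᵥ (R *ᵥ (T *ᵥ v))) = (T *ᵥ v) ⬝ᵥ (A *ᵥ (T *ᵥ v)) := by
    rw [mulVec_mulVec _ A, hRT, ← mulVec_mulVec, mulVec_dotProduct_eq]
  simp only [mulVec_smul, dotProduct_smul, smul_dotProduct, smul_eq_mul, h3] at h2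
  have h4 := mul_le_mul_of_nonneg_left h2 hc.le
  have h5 := mul_le_mul_of_nonneg_left h1 (inv_pos.2 hc).le
  set a := (T *ᵥ v) ⬝ᵥ (A *ᵥ (T *ᵥ v))
  set b := (R *ᵥ (T *ᵥ v)) ⬝ᵥ (A *ᵥ (R *ᵥ (T *ᵥ v)))
  have e1 : c * (2 * (c⁻¹ * a) - c⁻¹ * (c⁻¹ * b)) = 2 * a - c⁻¹ * b := by field_simp
  have e2 : c⁻¹ * (c * a) = a := by field_simp
  linarith

variable [DecidableEq m]

theorem _root_.Matrix.PosDef.inv_mulVec_mulVec {A : Matrix m m ℝ} (hA : A.PosDef) (v : m → ℝ) :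
    A⁻¹ *ᵥ (A *ᵥ v) = v := by
  rw [mulVec_mulVec, nonsing_inv_mul _ ((isUnit_iff_isUnit_det _).1 hA.isUnit), one_mulVec]

theorem _root_.Matrix.PosDef.mulVec_inv_mulVec {A : Matrix m m ℝ} (hA : A.PosDef) (v : m → ℝ) :
    A *ᵥ (A⁻¹ *ᵥ v) = v := by
  rw [mulVec_mulVec, mul_nonsing_inv _ ((isUnit_iff_isUnit_det _).1 hA.isUnit), one_mulVec]

/-- The Fenchel-Young inequality for the dual pair of quadratic forms of `A` and `A⁻¹`. -/
theorem two_mul_dotProduct_sub_le {A : Matrix m m ℝ} (hA : A.PosDef) (x y : m → ℝ) :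
    2 * (x ⬝ᵥ y) - y ⬝ᵥ (A *ᵥ y) ≤ x ⬝ᵥ (A⁻¹ *ᵥ x) := by
  have h := two_mul_form_sub_le hA.posSemidef (A⁻¹ *ᵥ x) y
  have h1 : (A⁻¹ *ᵥ x) ⬝ᵥ (A *ᵥ y) = x ⬝ᵥ y := by
    rw [mulVec_dotProduct_eq, hA.inv.transpose_eq, hA.inv_mulVec_mulVec]
  rw [h1, hA.mulVec_inv_mulVec, dotProduct_comm (A⁻¹ *ᵥ x) x] at h
  exact h

/-- Inversion reverses the Loewner order: `c A⁻¹ ≤ N`, written as `c A ≤ A N A`, gives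
`N⁻¹ ≤ c⁻¹ A`. -/
theorem inv_form_le_of_le {A N : Matrix m m ℝ} (hA : A.PosDef) (hN : N.PosDef) {c : ℝ}
    (hc : 0 < c) (h : ∀ v, c * (v ⬝ᵥ (A *ᵥ v)) ≤ (A *ᵥ v) ⬝ᵥ (N *ᵥ (A *ᵥ v))) (v : m → ℝ) :
    v ⬝ᵥ (N⁻¹ *ᵥ v) ≤ v ⬝ᵥ (A *ᵥ v) / c := by
  set q := N⁻¹ *ᵥ v with hq
  have h1 := h (A⁻¹ *ᵥ q)
  rw [hA.mulVec_inv_mulVec, show N *ᵥ q = v from hN.mulVec_inv_mulVec v,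
    dotProduct_comm q v] at h1
  have h2 := two_mul_form_sub_le hA.posSemidef (A⁻¹ *ᵥ q) (c⁻¹ • v)
  rw [hA.mulVec_inv_mulVec, dotProduct_mulVec_comm_of_symm hA.transpose_eq _ (c⁻¹ • v),
    hA.mulVec_inv_mulVec] at h2
  simp only [mulVec_smul, dotProduct_smul, smul_dotProduct, smul_eq_mul] at h2
  have h3 := mul_le_mul_of_nonneg_left h2 hc.le
  have e1 : c * (2 * (c⁻¹ * (v ⬝ᵥ q)) - c⁻¹ * (c⁻¹ * (v ⬝ᵥ (A *ᵥ v)))) =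
      2 * (v ⬝ᵥ q) - v ⬝ᵥ (A *ᵥ v) / c := by
    field_simp
  linarith

end QuadraticForms

/-! ### Powers of operators that are self-adjoint in the energy inner product -/

section SelfAdjoint

variable {m : Type*} [Fintype m]

/-- An operator `E` that is self-adjoint and satisfies `0 ≤ E ≤ x` in the inner product of `A`
has operator norm at most `x`. -/
theorem form_mulVec_le {A E : Matrix m m ℝ} (hsymm : (A * E)ᵀ = A * E)
    {x : ℝ} (hx : 0 < x) (h0 : ∀ v, 0 ≤ v ⬝ᵥ (A *ᵥ (E *ᵥ v)))
    (h1 : ∀ v, v ⬝ᵥ (A *ᵥ (E *ᵥ v)) ≤ x * (v ⬝ᵥ (A *ᵥ v))) (v : m → ℝ) :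
    (E *ᵥ v) ⬝ᵥ (A *ᵥ (E *ᵥ v)) ≤ x ^ 2 * (v ⬝ᵥ (A *ᵥ v)) := by
  have hAE : (A * E).PosSemidef :=
    .of_dotProduct_mulVec_nonneg (by simpa [IsHermitian] using hsymm)
      fun v => by simpa [← mulVec_mulVec] using h0 v
  have h2 := two_mul_form_sub_le hAE v (x⁻¹ • (E *ᵥ v))
  rw [dotProduct_mulVec_comm_of_symm hAE.transpose_eq v] at h2
  simp only [mulVec_smul, dotProduct_smul, smul_dotProduct, smul_eq_mul, ← mulVec_mulVec] at h2
  have h3 := h1 (E *ᵥ v)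
  have h4 := h1 v
  set a := (E *ᵥ v) ⬝ᵥ (A *ᵥ (E *ᵥ v))
  set b := (E *ᵥ v) ⬝ᵥ (A *ᵥ (E *ᵥ (E *ᵥ v)))
  set d := v ⬝ᵥ (A *ᵥ (E *ᵥ v))
  have h5 := mul_le_mul_of_nonneg_left h2 hx.le
  have h6 := mul_le_mul_of_nonneg_left h3 (inv_pos.2 hx).le
  have e1 : x * (2 * (x⁻¹ * a) - x⁻¹ * (x⁻¹ * b)) = 2 * a - x⁻¹ * b := by field_simp
  have e2 : x⁻¹ * (x * a) = a := by field_simp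
  have h7 := mul_le_mul_of_nonneg_left h4 hx.le
  linarith [sq x, mul_assoc x x (v ⬝ᵥ (A *ᵥ v))]

variable [DecidableEq m]

theorem mul_pow_transpose {A E : Matrix m m ℝ} (hA : Aᵀ = A) (hsymm : (A * E)ᵀ = A * E) (γ : ℕ) :
    (A * E ^ γ)ᵀ = A * E ^ γ := by
  have h1 : Eᵀ * A = A * E := by simpa [transpose_mul, hA] using hsymm
  have h2 : (Eᵀ) ^ γ * A = A * E ^ γ := by
    induction γ with
    | zero => simp
    | succ n ih => rw [pow_succ, Matrix.mul_assoc, h1, ← Matrix.mul_assoc, ih, Matrix.mul_assoc,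
        ← pow_succ]
  rw [transpose_mul, transpose_pow, hA, h2]

/-- The powers of an operator with `0 ≤ E ≤ x` satisfy `0 ≤ E ^ γ ≤ x ^ γ`: by self-adjointness the
form of `E ^ (γ + 2)` at `v` is that of `E ^ γ` at `E v`. -/
theorem form_pow_mem {A E : Matrix m m ℝ} (hsymm : (A * E)ᵀ = A * E)
    {x : ℝ} (hx : 0 < x) (hA : A.PosDef) (h0 : ∀ v, 0 ≤ v ⬝ᵥ (A *ᵥ (E *ᵥ v)))
    (h1 : ∀ v, v ⬝ᵥ (A *ᵥ (E *ᵥ v)) ≤ x * (v ⬝ᵥ (A *ᵥ v))) (γ : ℕ) (v : m → ℝ) :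
    0 ≤ v ⬝ᵥ (A *ᵥ (E ^ γ *ᵥ v)) ∧
      v ⬝ᵥ (A *ᵥ (E ^ γ *ᵥ v)) ≤ x ^ γ * (v ⬝ᵥ (A *ᵥ v)) := by
  induction γ using Nat.twoStepInduction generalizing v with
  | zero => simpa using hA.posSemidef.form_nonneg v
  | one => simpa only [pow_one] using And.intro (h0 v) (h1 v)
  | more n ih _ =>
    have e : v ⬝ᵥ (A *ᵥ (E ^ (n + 2) *ᵥ v)) = (E *ᵥ v) ⬝ᵥ (A *ᵥ (E ^ n *ᵥ (E *ᵥ v))) := by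
      have h1 : A * E = Eᵀ * A := by
        rw [← hsymm, transpose_mul, hA.transpose_eq]
      rw [pow_succ', pow_succ, ← mulVec_mulVec, mulVec_mulVec _ A, h1, mulVec_dotProduct_eq]
      simp only [mulVec_mulVec, Matrix.mul_assoc]
    rw [e]
    refine ⟨(ih _).1, (ih _).2.trans ?_⟩
    have h2 := mul_le_mul_of_nonneg_left (form_mulVec_le hsymm hx h0 h1 v) (pow_pos hx n).le
    calc _ ≤ _ := h2
      _ = _ := by ring

end SelfAdjoint

/-! ### Extreme generalized eigenvalues -/

section Spectrum

variable {m : Type*} [Fintype m] [DecidableEq m]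

theorem mem_spectrum_iff_exists_mulVec {B : Matrix m m ℝ} {μ : ℝ} :
    μ ∈ spectrum ℝ B ↔ ∃ v ≠ 0, B *ᵥ v = μ • v := by
  rw [spectrum.mem_iff, isUnit_iff_isUnit_det, isUnit_iff_ne_zero, not_not,
    ← exists_mulVec_eq_zero_iff]
  refine exists_congr fun v => and_congr_right fun _ => ?_
  rw [sub_mulVec, Algebra.algebraMap_eq_smul_one, smul_mulVec, one_mulVec, sub_eq_zero, eq_comm]

/-- The maximum `μ` of the generalized Rayleigh quotient `⟨C v, v⟩ / ⟨X v, v⟩` is an eigenvalue of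
`X⁻¹ C`: at a maximizer the positive semidefinite form of `μ X - C` vanishes. -/
theorem exists_mem_spectrum_form_le [Nonempty m] {X C : Matrix m m ℝ} (hX : X.PosDef)
    (hC : Cᵀ = C) :
    ∃ μ ∈ spectrum ℝ (X⁻¹ * C), ∀ v, v ⬝ᵥ (C *ᵥ v) ≤ μ * (v ⬝ᵥ (X *ᵥ v)) := by
  have hcont : ∀ B : Matrix m m ℝ, Continuous fun v : m → ℝ => v ⬝ᵥ (B *ᵥ v) := fun B => by
    fun_prop
  obtain ⟨v₀, hv₀, hmax⟩ := (isCompact_sphere (0 : m → ℝ) 1).exists_isMaxOn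
    (NormedSpace.sphere_nonempty.2 zero_le_one)
    (f := fun v => v ⬝ᵥ (C *ᵥ v) / (v ⬝ᵥ (X *ᵥ v)))
    ((hcont C).continuousOn.div (hcont X).continuousOn fun v hv =>
      (hX.form_pos (ne_zero_of_mem_unit_sphere ⟨v, hv⟩)).ne')
  have hv₀' : v₀ ≠ 0 := ne_zero_of_mem_unit_sphere ⟨v₀, hv₀⟩
  set μ := v₀ ⬝ᵥ (C *ᵥ v₀) / (v₀ ⬝ᵥ (X *ᵥ v₀)) with hμ
  have hle : ∀ v, v ⬝ᵥ (C *ᵥ v) ≤ μ * (v ⬝ᵥ (X *ᵥ v)) := by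
    intro v
    rcases eq_or_ne v 0 with rfl | hv
    · simp
    have hn : ‖v‖ ≠ 0 := norm_ne_zero_iff.2 hv
    have h1 := hmax (show ‖v‖⁻¹ • v ∈ Metric.sphere (0 : m → ℝ) 1 by
      simp [norm_smul, hn])
    simp only [Set.mem_ofPred_eq, mulVec_smul, dotProduct_smul, smul_dotProduct, smul_eq_mul] at h1
    rw [mul_div_mul_left _ _ (inv_ne_zero hn), mul_div_mul_left _ _ (inv_ne_zero hn),
      div_le_iff₀ (hX.form_pos hv)] at h1
    exact h1
  refine ⟨μ, mem_spectrum_iff_exists_mulVec.2 ⟨v₀, hv₀', ?_⟩, hle⟩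
  have hpsd : (μ • X - C).PosSemidef := by
    refine .of_dotProduct_mulVec_nonneg ?_ fun v => ?_
    · simp [IsHermitian, hC, hX.transpose_eq]
    · simpa [sub_mulVec, smul_mulVec] using hle v
  have h0 := (hpsd.dotProduct_mulVec_zero_iff v₀).1 (by
    simp only [star_trivial, sub_mulVec, smul_mulVec, dotProduct_sub, dotProduct_smul, smul_eq_mul]
    rw [hμ, div_mul_cancel₀ _ (hX.form_pos hv₀').ne', sub_self])
  rw [sub_mulVec, sub_eq_zero, smul_mulVec] at h0
  rw [← mulVec_mulVec, ← h0, mulVec_smul, hX.inv_mulVec_mulVec]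

theorem form_le_lamMax_mul [Nonempty m] {X C : Matrix m m ℝ} (hX : X.PosDef) (hC : Cᵀ = C)
    (v : m → ℝ) : v ⬝ᵥ (C *ᵥ v) ≤ lamMax (X⁻¹ * C) * (v ⬝ᵥ (X *ᵥ v)) := by
  obtain ⟨μ, hμ, h⟩ := exists_mem_spectrum_form_le hX hC
  exact (h v).trans (mul_le_mul_of_nonneg_right
    (le_csSup finite_real_spectrum.bddAbove hμ) (hX.posSemidef.form_nonneg v))

theorem lamMin_mul_le_form [Nonempty m] {X C : Matrix m m ℝ} (hX : X.PosDef) (hC : Cᵀ = C)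
    (v : m → ℝ) : lamMin (X⁻¹ * C) * (v ⬝ᵥ (X *ᵥ v)) ≤ v ⬝ᵥ (C *ᵥ v) := by
  obtain ⟨μ, hμ, h⟩ := exists_mem_spectrum_form_le (C := -C) hX (by simp [hC])
  have h1 := h v
  rw [neg_mulVec, dotProduct_neg] at h1
  have h2 : -μ ∈ spectrum ℝ (X⁻¹ * C) := by
    rw [← neg_neg (X⁻¹ * C), ← Matrix.mul_neg, ← spectrum.neg_eq]
    simpa using hμ
  have h3 := mul_le_mul_of_nonneg_right (csInf_le finite_real_spectrum.bddBelow h2)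
    (hX.posSemidef.form_nonneg v)
  unfold lamMin
  linarith

theorem pos_of_mem_spectrum {X C : Matrix m m ℝ} (hX : X.PosDef) (hC : C.PosDef) {μ : ℝ}
    (hμ : μ ∈ spectrum ℝ (X⁻¹ * C)) : 0 < μ := by
  obtain ⟨v, hv, h⟩ := mem_spectrum_iff_exists_mulVec.1 hμ
  have h1 : C *ᵥ v = μ • (X *ᵥ v) := by
    rw [← mulVec_smul, ← h, ← mulVec_mulVec, hX.mulVec_inv_mulVec]
  have h2 := hC.form_pos hv
  rw [h1, dotProduct_smul, smul_eq_mul] at h2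
  exact pos_of_mul_pos_left h2 (hX.form_pos hv).le

theorem lamMin_pos [Nonempty m] {X C : Matrix m m ℝ} (hX : X.PosDef) (hC : C.PosDef) :
    0 < lamMin (X⁻¹ * C) := by
  obtain ⟨μ, hμ, -⟩ := exists_mem_spectrum_form_le hX hC.transpose_eq
  exact pos_of_mem_spectrum hX hC
    (Set.Nonempty.csInf_mem ⟨μ, hμ⟩ finite_real_spectrum)

theorem lamMax_pos [Nonempty m] {X C : Matrix m m ℝ} (hX : X.PosDef) (hC : C.PosDef) :
    0 < lamMax (X⁻¹ * C) := by
  obtain ⟨μ, hμ, -⟩ := exists_mem_spectrum_form_le hX hC.transpose_eq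
  exact (pos_of_mem_spectrum hX hC hμ).trans_le (le_csSup finite_real_spectrum.bddAbove hμ)

end Spectrum

/-! ### One symmetric two-grid step -/

section TwoGrid

variable {m c : Type*} [Fintype m] [DecidableEq m] [Fintype c]

/-- The operator `M⁻ᵀ (M + Mᵀ - A) M⁻¹` with which post-smoothing after pre-smoothing acts on
residuals: `(1 - M⁻ᵀ A) (1 - M⁻¹ A) = 1 - smoothInv A M * A`. Its inverse is the symmetrization
`M (M + Mᵀ - A)⁻¹ Mᵀ`, in which `M` and `Mᵀ` are swapped in comparison with `symmSmoother`. -/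
noncomputable def smoothInv (A M : Matrix m m ℝ) : Matrix m m ℝ :=
  (Mᵀ)⁻¹ * (M + Mᵀ - A) * M⁻¹

/-- The coarse solver `S` satisfies `(Ac + δ Mc)⁻¹ ≤ S ≤ Ac⁻¹` in the Loewner order. The lower
bound is stated through the Legendre transform of the form of `Ac + δ Mc`. -/
structure IsApproxInv [DecidableEq c] (Ac Mc S : Matrix c c ℝ) (δ : ℝ) : Prop where
  symm : Sᵀ = S
  form_le : ∀ g, g ⬝ᵥ (S *ᵥ g) ≤ g ⬝ᵥ (Ac⁻¹ *ᵥ g)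
  le_form : ∀ g y, 2 * (g ⬝ᵥ y) - (y ⬝ᵥ (Ac *ᵥ y) + δ * (y ⬝ᵥ (Mc *ᵥ y))) ≤ g ⬝ᵥ (S *ᵥ g)

theorem IsApproxInv.form_nonneg [DecidableEq c] {Ac Mc S : Matrix c c ℝ} {δ : ℝ}
    (h : IsApproxInv Ac Mc S δ) (g : c → ℝ) : 0 ≤ g ⬝ᵥ (S *ᵥ g) := by
  simpa using h.le_form g 0

variable {A M : Matrix m m ℝ} {P : Matrix m c ℝ} {S : Matrix c c ℝ}

theorem mul_postSmooth (hA : Aᵀ = A) : A * (1 - (Mᵀ)⁻¹ * A) = (1 - M⁻¹ * A)ᵀ * A := by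
  rw [transpose_sub, transpose_mul, hA, transpose_nonsing_inv, transpose_one]
  noncomm_ring

theorem mul_preSmooth (hA : Aᵀ = A) : A * (1 - M⁻¹ * A) = (1 - (Mᵀ)⁻¹ * A)ᵀ * A := by
  rw [transpose_sub, transpose_mul, hA, transpose_nonsing_inv, transpose_one,
    transpose_transpose]
  noncomm_ring

theorem smoothInv_eq (hM : IsUnit M) :
    smoothInv A M = (Mᵀ)⁻¹ + M⁻¹ - (Mᵀ)⁻¹ * A * M⁻¹ := by
  have h1 := (isUnit_iff_isUnit_det _).1 hM
  have h2 : IsUnit (Mᵀ).det := by rwa [det_transpose]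
  rw [smoothInv, Matrix.mul_sub, Matrix.mul_add, nonsing_inv_mul _ h2, Matrix.sub_mul,
    Matrix.add_mul, Matrix.mul_assoc, mul_nonsing_inv _ h1, Matrix.mul_one, Matrix.one_mul]

theorem postSmooth_mul_preSmooth (hM : IsUnit M) :
    (1 - (Mᵀ)⁻¹ * A) * (1 - M⁻¹ * A) = 1 - smoothInv A M * A := by
  rw [smoothInv_eq hM]
  noncomm_ring

theorem smoothInv_posDef (hM : IsUnit M) (hW : (M + Mᵀ - A).PosDef) : (smoothInv A M).PosDef := by
  have h := hW.conjTranspose_mul_mul_same (B := M⁻¹)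
    (mulVec_injective_iff_isUnit.2 (by simpa using hM))
  rwa [conjTranspose_eq_transpose_of_trivial, transpose_nonsing_inv] at h

theorem symmSmoother_posDef (hM : IsUnit M) (hW : (M + Mᵀ - A).PosDef) :
    (symmSmoother A M).PosDef := by
  have h := hW.inv.conjTranspose_mul_mul_same (B := M) (mulVec_injective_iff_isUnit.2 hM)
  rwa [conjTranspose_eq_transpose_of_trivial] at h

theorem inv_smoothInv (hM : IsUnit M) : (smoothInv A M)⁻¹ = M * (M + Mᵀ - A)⁻¹ * Mᵀ := by
  have h1 := (isUnit_iff_isUnit_det _).1 hM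
  have h2 : IsUnit (Mᵀ).det := by rwa [det_transpose]
  rw [smoothInv, Matrix.mul_inv_rev, Matrix.mul_inv_rev, nonsing_inv_nonsing_inv _ h1,
    nonsing_inv_nonsing_inv _ h2, Matrix.mul_assoc]

theorem inv_symmSmoother (hM : IsUnit M) (hW : (M + Mᵀ - A).PosDef) :
    (symmSmoother A M)⁻¹ = M⁻¹ + (Mᵀ)⁻¹ - M⁻¹ * A * (Mᵀ)⁻¹ := by
  have h1 := (isUnit_iff_isUnit_det _).1 hM
  have h2 : IsUnit (Mᵀ).det := by rwa [det_transpose]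
  rw [symmSmoother, Matrix.mul_inv_rev, Matrix.mul_inv_rev,
    nonsing_inv_nonsing_inv _ ((isUnit_iff_isUnit_det _).1 hW.isUnit), Matrix.sub_mul,
    Matrix.add_mul, mul_nonsing_inv _ h2, Matrix.mul_sub, Matrix.mul_add, ← Matrix.mul_assoc,
    nonsing_inv_mul _ h1, Matrix.mul_one, Matrix.one_mul, ← Matrix.mul_assoc]
  abel

/-- With `M̄ = M (M + Mᵀ - A)⁻¹ Mᵀ` and `M̃ = symmSmoother A M`, this is the identity
`(1 - A M⁻¹) M̄ (1 - M⁻ᵀ A) = M̃ - A`. It turns the correction term of the inexact coarse solver,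
measured by `M̃`, into energies that the exact two-grid splitting already contains. -/
theorem postSmooth_form (hM : IsUnit M) (hW : (M + Mᵀ - A).PosDef) (p : m → ℝ) :
    ((1 - (Mᵀ)⁻¹ * A) *ᵥ p) ⬝ᵥ ((smoothInv A M)⁻¹ *ᵥ ((1 - (Mᵀ)⁻¹ * A) *ᵥ p)) =
      p ⬝ᵥ (symmSmoother A M *ᵥ p) - p ⬝ᵥ (A *ᵥ p) := by
  have h1 := (isUnit_iff_isUnit_det _).1 hM
  have h2 : IsUnit (Mᵀ).det := by rwa [det_transpose]
  have h3 := (isUnit_iff_isUnit_det _).1 hW.isUnit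
  set W := M + Mᵀ - A with hWdef
  have e1 : Mᵀ * (1 - (Mᵀ)⁻¹ * A) = W - M := by
    rw [Matrix.mul_sub, ← Matrix.mul_assoc, mul_nonsing_inv _ h2, Matrix.mul_one, Matrix.one_mul,
      hWdef]
    abel
  have e2 : (1 - (Mᵀ)⁻¹ * A)ᵀ * M = W - Mᵀ := by
    have := congrArg transpose e1
    rwa [transpose_mul, transpose_transpose, transpose_sub W, hW.transpose_eq] at this
  have e3 : (1 - (Mᵀ)⁻¹ * A)ᵀ * ((smoothInv A M)⁻¹ * (1 - (Mᵀ)⁻¹ * A)) = symmSmoother A M - A := by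
    rw [inv_smoothInv hM, ← hWdef]
    calc _ = ((1 - (Mᵀ)⁻¹ * A)ᵀ * M) * W⁻¹ * (Mᵀ * (1 - (Mᵀ)⁻¹ * A)) := by
          simp only [Matrix.mul_assoc]
      _ = (W * W⁻¹) * W - (W * W⁻¹) * M - Mᵀ * (W⁻¹ * W) + Mᵀ * W⁻¹ * M := by
          rw [e1, e2]; noncomm_ring
      _ = _ := by
          rw [mul_nonsing_inv _ h3, nonsing_inv_mul _ h3, Matrix.mul_one, Matrix.one_mul,
            Matrix.one_mul, symmSmoother, ← hWdef, hWdef]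
          abel
  rw [mulVec_dotProduct_eq, mulVec_mulVec, mulVec_mulVec, Matrix.mul_assoc, e3, sub_mulVec,
    dotProduct_sub]

theorem mul_twoGridIter (hA : Aᵀ = A) :
    A * twoGridIter A M P S =
      (1 - M⁻¹ * A)ᵀ * (A - A * P * S * Pᵀ * A) * (1 - M⁻¹ * A) := by
  rw [twoGridIter, ← Matrix.mul_assoc, ← Matrix.mul_assoc, mul_postSmooth hA]
  simp only [Matrix.mul_assoc, Matrix.mul_sub, Matrix.sub_mul, Matrix.mul_one]

theorem mul_twoGridIter_transpose (hA : Aᵀ = A) (hS : Sᵀ = S) :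
    (A * twoGridIter A M P S)ᵀ = A * twoGridIter A M P S := by
  simp only [mul_twoGridIter hA, transpose_mul, transpose_sub, transpose_transpose, hA, hS,
    Matrix.mul_assoc]

theorem twoGridIter_form (hA : Aᵀ = A) (v : m → ℝ) :
    v ⬝ᵥ (A *ᵥ (twoGridIter A M P S *ᵥ v)) =
      ((1 - M⁻¹ * A) *ᵥ v) ⬝ᵥ (A *ᵥ ((1 - M⁻¹ * A) *ᵥ v)) -
        (Pᵀ *ᵥ (A *ᵥ ((1 - M⁻¹ * A) *ᵥ v))) ⬝ᵥ
          (S *ᵥ (Pᵀ *ᵥ (A *ᵥ ((1 - M⁻¹ * A) *ᵥ v)))) := by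
  rw [mulVec_mulVec, mul_twoGridIter hA, mulVec_dotProduct_eq Pᵀ, mulVec_dotProduct_eq A,
    mulVec_dotProduct_eq (1 - M⁻¹ * A), mulVec_dotProduct_eq (1 - M⁻¹ * A), ← dotProduct_sub,
    ← mulVec_sub, transpose_transpose, hA]
  simp only [← mulVec_mulVec, sub_mulVec]

/-- The error form of a two-grid step through the preconditioner
`smoothInv A M + (1 - M⁻ᵀ A) P S Pᵀ (1 - A M⁻¹)`. -/
theorem twoGridIter_form_eq_sub (hA : Aᵀ = A) (hM : IsUnit M) (v : m → ℝ) :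
    v ⬝ᵥ (A *ᵥ (twoGridIter A M P S *ᵥ v)) =
      v ⬝ᵥ (A *ᵥ v) - ((A *ᵥ v) ⬝ᵥ (smoothInv A M *ᵥ (A *ᵥ v)) +
        (Pᵀ *ᵥ ((1 - (Mᵀ)⁻¹ * A)ᵀ *ᵥ (A *ᵥ v))) ⬝ᵥ
          (S *ᵥ (Pᵀ *ᵥ ((1 - (Mᵀ)⁻¹ * A)ᵀ *ᵥ (A *ᵥ v))))) := by
  have e : ((1 - M⁻¹ * A) *ᵥ v) ⬝ᵥ (A *ᵥ ((1 - M⁻¹ * A) *ᵥ v)) =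
      v ⬝ᵥ (A *ᵥ v) - (A *ᵥ v) ⬝ᵥ (smoothInv A M *ᵥ (A *ᵥ v)) := by
    rw [mulVec_dotProduct_eq, mulVec_mulVec _ A, mulVec_mulVec, ← Matrix.mul_assoc,
      ← mul_postSmooth hA, Matrix.mul_assoc, postSmooth_mul_preSmooth hM, Matrix.mul_sub,
      Matrix.mul_one, sub_mulVec, dotProduct_sub, mulVec_dotProduct_eq A, hA]
    simp only [mulVec_mulVec]
  have e' : A *ᵥ ((1 - M⁻¹ * A) *ᵥ v) = (1 - (Mᵀ)⁻¹ * A)ᵀ *ᵥ (A *ᵥ v) := by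
    rw [mulVec_mulVec, mul_preSmooth hA, mulVec_mulVec]
  rw [twoGridIter_form hA, e, e']
  ring

/-- Pre-smoothing contracts the energy by `1 - ε`, where `ε` is a lower bound for the spectrum
of `M̃⁻¹ A`, `M̃ = symmSmoother A M`. -/
theorem smooth_le (hA : A.PosDef) (hM : IsUnit M) (hW : (M + Mᵀ - A).PosDef) {ε : ℝ}
    (hε0 : 0 < ε) (hε1 : ε < 1)
    (hε : ∀ v, ε * (v ⬝ᵥ (symmSmoother A M *ᵥ v)) ≤ v ⬝ᵥ (A *ᵥ v)) (v : m → ℝ) :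
    ((1 - M⁻¹ * A) *ᵥ v) ⬝ᵥ (A *ᵥ ((1 - M⁻¹ * A) *ᵥ v)) ≤ (1 - ε) * (v ⬝ᵥ (A *ᵥ v)) := by
  refine form_adjoint_le hA (mul_postSmooth hA.transpose_eq) (sub_pos.2 hε1) (fun u => ?_) v
  have hX := symmSmoother_posDef hM hW
  have key : (1 - M⁻¹ * A) * (1 - (Mᵀ)⁻¹ * A) = 1 - (symmSmoother A M)⁻¹ * A := by
    rw [inv_symmSmoother hM hW]
    noncomm_ring
  have e : ((1 - (Mᵀ)⁻¹ * A) *ᵥ u) ⬝ᵥ (A *ᵥ ((1 - (Mᵀ)⁻¹ * A) *ᵥ u)) =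
      u ⬝ᵥ (A *ᵥ u) - (A *ᵥ u) ⬝ᵥ ((symmSmoother A M)⁻¹ *ᵥ (A *ᵥ u)) := by
    rw [mulVec_dotProduct_eq, mulVec_mulVec _ A, mulVec_mulVec, ← Matrix.mul_assoc,
      ← mul_preSmooth hA.transpose_eq, Matrix.mul_assoc, key, Matrix.mul_sub,
      Matrix.mul_one, sub_mulVec, dotProduct_sub,
      mulVec_dotProduct_eq A, hA.transpose_eq]
    simp only [mulVec_mulVec]
  rw [e]
  have h2 := two_mul_dotProduct_sub_le hX (A *ᵥ u) (ε • u)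
  simp only [mulVec_smul, dotProduct_smul, smul_dotProduct, smul_eq_mul] at h2
  rw [dotProduct_comm (A *ᵥ u) u] at h2
  have h3 := mul_le_mul_of_nonneg_left (hε u) hε0.le
  linarith

theorem twoGridIter_form_nonneg [DecidableEq c] {Ac : Matrix c c ℝ} (hA : A.PosDef)
    (hAc : Ac.PosDef) (hgal : Ac = Pᵀ * A * P) (hS : ∀ g, g ⬝ᵥ (S *ᵥ g) ≤ g ⬝ᵥ (Ac⁻¹ *ᵥ g))
    (v : m → ℝ) : 0 ≤ v ⬝ᵥ (A *ᵥ (twoGridIter A M P S *ᵥ v)) := by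
  rw [twoGridIter_form hA.transpose_eq]
  set u := (1 - M⁻¹ * A) *ᵥ v
  set g := Pᵀ *ᵥ (A *ᵥ u) with hg
  have h1 := two_mul_form_sub_le hA.posSemidef u (P *ᵥ (Ac⁻¹ *ᵥ g))
  have h2 : u ⬝ᵥ (A *ᵥ (P *ᵥ (Ac⁻¹ *ᵥ g))) = g ⬝ᵥ (Ac⁻¹ *ᵥ g) := by
    rw [hg, mulVec_dotProduct_eq Pᵀ, mulVec_dotProduct_eq A, hA.transpose_eq, transpose_transpose]
  have h3 : (P *ᵥ (Ac⁻¹ *ᵥ g)) ⬝ᵥ (A *ᵥ (P *ᵥ (Ac⁻¹ *ᵥ g))) = g ⬝ᵥ (Ac⁻¹ *ᵥ g) := by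
    have e : Pᵀ *ᵥ (A *ᵥ (P *ᵥ (Ac⁻¹ *ᵥ g))) = Ac *ᵥ (Ac⁻¹ *ᵥ g) := by
      rw [hgal]; simp only [mulVec_mulVec, Matrix.mul_assoc]
    rw [mulVec_dotProduct_eq, e, hAc.mulVec_inv_mulVec, dotProduct_comm]
  linarith [hS g]

theorem twoGridIter_form_le_smooth (hA : Aᵀ = A) (hS : ∀ g, 0 ≤ g ⬝ᵥ (S *ᵥ g)) (v : m → ℝ) :
    v ⬝ᵥ (A *ᵥ (twoGridIter A M P S *ᵥ v)) ≤
      ((1 - M⁻¹ * A) *ᵥ v) ⬝ᵥ (A *ᵥ ((1 - M⁻¹ * A) *ᵥ v)) := by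
  rw [twoGridIter_form hA]
  linarith [hS (Pᵀ *ᵥ (A *ᵥ ((1 - M⁻¹ * A) *ᵥ v)))]

/-- A convergence factor `σ` of the exact two-grid step provides, for each `v`, a splitting
`v = w + (1 - M⁻ᵀ A) P y` into a smoothed and a coarse part whose energies sum to at most
`⟨A v, v⟩ / (1 - σ)`. -/
theorem exists_splitting [DecidableEq c] {Ac : Matrix c c ℝ} (hA : A.PosDef) (hM : IsUnit M)
    (hW : (M + Mᵀ - A).PosDef) (hAc : Ac.PosDef) {σ : ℝ} (hσ : σ < 1)
    (hTG : ∀ v, v ⬝ᵥ (A *ᵥ (twoGridIter A M P Ac⁻¹ *ᵥ v)) ≤ σ * (v ⬝ᵥ (A *ᵥ v))) (v : m → ℝ) :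
    ∃ (w : m → ℝ) (y : c → ℝ), v = w + (1 - (Mᵀ)⁻¹ * A) *ᵥ (P *ᵥ y) ∧
      w ⬝ᵥ ((smoothInv A M)⁻¹ *ᵥ w) + y ⬝ᵥ (Ac *ᵥ y) ≤ v ⬝ᵥ (A *ᵥ v) / (1 - σ) := by
  set R := 1 - (Mᵀ)⁻¹ * A with hR
  have hN := smoothInv_posDef hM hW
  set J := smoothInv A M + (R * P) * Ac⁻¹ * (R * P)ᵀ with hJdef
  have hJmul : ∀ f, J *ᵥ f = smoothInv A M *ᵥ f + R *ᵥ (P *ᵥ (Ac⁻¹ *ᵥ (Pᵀ *ᵥ (Rᵀ *ᵥ f)))) :=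
    fun f => by simp only [hJdef, add_mulVec, mulVec_mulVec, transpose_mul, Matrix.mul_assoc]
  have hform : ∀ f, f ⬝ᵥ (J *ᵥ f) = f ⬝ᵥ (smoothInv A M *ᵥ f) +
      (Pᵀ *ᵥ (Rᵀ *ᵥ f)) ⬝ᵥ (Ac⁻¹ *ᵥ (Pᵀ *ᵥ (Rᵀ *ᵥ f))) := fun f => by
    rw [hJmul, dotProduct_add, mulVec_dotProduct_eq Pᵀ, mulVec_dotProduct_eq Rᵀ,
      transpose_transpose, transpose_transpose]
  have hJ : J.PosDef := by
    refine hN.add_posSemidef ?_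
    have := hAc.inv.posSemidef.mul_mul_conjTranspose_same (R * P)
    rwa [conjTranspose_eq_transpose_of_trivial] at this
  have hJle := inv_form_le_of_le hA hJ (sub_pos.2 hσ) (fun u => by
    have h1 := hTG u
    rw [twoGridIter_form_eq_sub hA.transpose_eq hM, ← hR, ← hform] at h1
    linarith) v
  set g := J⁻¹ *ᵥ v with hg
  have hJg : J *ᵥ g = v := hJ.mulVec_inv_mulVec v
  refine ⟨smoothInv A M *ᵥ g, Ac⁻¹ *ᵥ (Pᵀ *ᵥ (Rᵀ *ᵥ g)), by rw [← hJmul, hJg], ?_⟩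
  rw [hN.inv_mulVec_mulVec, hAc.mulVec_inv_mulVec, dotProduct_comm _ g,
    dotProduct_comm _ (Pᵀ *ᵥ (Rᵀ *ᵥ g)), ← hform, hJg, dotProduct_comm]
  exact hJle

/-- The quantitative comparison of an inexact with the exact two-grid step. The optimal splitting
of `v` for the exact step is averaged, with weights `1 / (1 + δ)` and `δ / (1 + δ)`, with the
trivial splitting `v = v + 0`. -/
theorem twoGridIter_form_le [DecidableEq c] {Ac : Matrix c c ℝ} {δ σ ε x : ℝ} (hA : A.PosDef)
    (hM : IsUnit M) (hW : (M + Mᵀ - A).PosDef) (hAc : Ac.PosDef) (hgal : Ac = Pᵀ * A * P)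
    (hδ : 0 ≤ δ) (hS : IsApproxInv Ac (Pᵀ * symmSmoother A M * P) S δ)
    (hσ : σ < 1) (hε0 : 0 < ε) (hε1 : ε < 1) (hx : x < 1)
    (hTG : ∀ v, v ⬝ᵥ (A *ᵥ (twoGridIter A M P Ac⁻¹ *ᵥ v)) ≤ σ * (v ⬝ᵥ (A *ᵥ v)))
    (hε : ∀ v, ε * (v ⬝ᵥ (symmSmoother A M *ᵥ v)) ≤ v ⬝ᵥ (A *ᵥ v))
    (hroot : δ * ((1 - σ) * (1 - ε - x)) = ε * (x - σ)) (v : m → ℝ) :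
    v ⬝ᵥ (A *ᵥ (twoGridIter A M P S *ᵥ v)) ≤ x * (v ⬝ᵥ (A *ᵥ v)) := by
  have hN := smoothInv_posDef hM hW
  have hsmooth : v ⬝ᵥ ((smoothInv A M)⁻¹ *ᵥ v) ≤ v ⬝ᵥ (A *ᵥ v) / ε := by
    refine inv_form_le_of_le hA hN hε0 (fun u => ?_) v
    have h1 := smooth_le hA hM hW hε0 hε1 hε u
    have h2 := twoGridIter_form_eq_sub (P := P) (S := 0) hA.transpose_eq hM u
    rw [twoGridIter_form hA.transpose_eq] at h2
    simp only [zero_mulVec, dotProduct_zero, sub_zero, add_zero] at h2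
    linarith
  obtain ⟨w, y, hv, hwy⟩ := exists_splitting hA hM hW hAc hσ hTG v
  rw [twoGridIter_form_eq_sub hA.transpose_eq hM]
  have hpost := postSmooth_form hM hW (P *ᵥ y)
  have hvf : v ⬝ᵥ (A *ᵥ v) = (A *ᵥ v) ⬝ᵥ w +
      (Pᵀ *ᵥ ((1 - (Mᵀ)⁻¹ * A)ᵀ *ᵥ (A *ᵥ v))) ⬝ᵥ y := by
    rw [mulVec_dotProduct_eq Pᵀ, mulVec_dotProduct_eq (1 - (Mᵀ)⁻¹ * A)ᵀ, transpose_transpose,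
      transpose_transpose, ← dotProduct_add, ← hv, dotProduct_comm]
  have hAy : (P *ᵥ y) ⬝ᵥ (A *ᵥ (P *ᵥ y)) = y ⬝ᵥ (Ac *ᵥ y) := by
    rw [mulVec_dotProduct_eq, hgal]; simp only [mulVec_mulVec, Matrix.mul_assoc]
  have hMy : (P *ᵥ y) ⬝ᵥ (symmSmoother A M *ᵥ (P *ᵥ y)) =
      y ⬝ᵥ ((Pᵀ * symmSmoother A M * P) *ᵥ y) := by
    rw [mulVec_dotProduct_eq]; simp only [mulVec_mulVec, Matrix.mul_assoc]
  have hq : (1 - (Mᵀ)⁻¹ * A) *ᵥ (P *ᵥ y) = v - w := by rw [hv]; abel_nf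
  rw [hq, hAy, hMy] at hpost
  -- With `s = 1 - x`, the splitting of `s v` is tested against the residual `A v`.
  have f1 := two_mul_dotProduct_sub_le hN.inv (A *ᵥ v)
    (((1 - x) / (1 + δ)) • w + ((1 - x) * δ / (1 + δ)) • v)
  have f2 := hS.le_form (Pᵀ *ᵥ ((1 - (Mᵀ)⁻¹ * A)ᵀ *ᵥ (A *ᵥ v))) (((1 - x) / (1 + δ)) • y)
  rw [nonsing_inv_nonsing_inv _ ((isUnit_iff_isUnit_det _).1 hN.isUnit)] at f1
  simp only [mulVec_add, mulVec_sub, mulVec_smul, dotProduct_add, dotProduct_sub, add_dotProduct,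
    sub_dotProduct, dotProduct_smul, smul_dotProduct, smul_eq_mul] at f1 f2 hpost
  rw [dotProduct_mulVec_comm_of_symm hN.inv.transpose_eq v w] at f1 hpost
  rw [dotProduct_comm (A *ᵥ v) v] at f1
  have f3 := add_le_add f1 f2
  set ww := w ⬝ᵥ ((smoothInv A M)⁻¹ *ᵥ w)
  set wv := w ⬝ᵥ ((smoothInv A M)⁻¹ *ᵥ v)
  set vv := v ⬝ᵥ ((smoothInv A M)⁻¹ *ᵥ v)
  set a := v ⬝ᵥ (A *ᵥ v)
  set yA := y ⬝ᵥ (Ac *ᵥ y)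
  set yM := y ⬝ᵥ ((Pᵀ * symmSmoother A M * P) *ᵥ y)
  set p := (A *ᵥ v) ⬝ᵥ w
  set q := (Pᵀ *ᵥ ((1 - (Mᵀ)⁻¹ * A)ᵀ *ᵥ (A *ᵥ v))) ⬝ᵥ y
  have hδ' : 0 < 1 + δ := by linarith
  have hσ' : 0 < 1 - σ := by linarith
  have hyM : yM = vv - 2 * wv + ww + yA := by linarith
  have hpq : q = a - p := by linarith
  refine le_trans (sub_le_sub_left f3 _) ?_
  rw [hyM, hpq]
  -- The cross terms cancel, and the energy of the averaged splitting is at most `a / (1 - x)`.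
  have hK : (1 - x) * (a / (1 - σ) + δ * (a / ε)) = (1 + δ) * a := by
    field_simp
    linear_combination a * hroot
  have hE : (1 - x) * (ww + yA + δ * vv) ≤ (1 + δ) * a := by
    rw [← hK]
    exact mul_le_mul_of_nonneg_left
      (add_le_add hwy (mul_le_mul_of_nonneg_left hsmooth hδ)) (by linarith)
  have hE' : (1 - x) * ((1 - x) * (ww + yA + δ * vv) / (1 + δ)) ≤ (1 - x) * a :=
    mul_le_mul_of_nonneg_left (by rwa [div_le_iff₀ hδ', mul_comm a]) (by linarith)
  refine le_trans (le_of_eq ?_) (show a - 2 * (1 - x) * a +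
    (1 - x) * ((1 - x) * (ww + yA + δ * vv) / (1 + δ)) ≤ _ by linarith)
  field_simp
  ring

/-- An error form between `0` and `x` makes `γ` steps of the iteration an approximate inverse. -/
theorem isApproxInv_iterate {X E : Matrix m m ℝ} (hA : A.PosDef) (hsymm : (A * E)ᵀ = A * E)
    {x τ δ : ℝ} {γ : ℕ} (hx0 : 0 < x) (hx1 : x < 1)
    (hγ : γ ≠ 0) (h0 : ∀ v, 0 ≤ v ⬝ᵥ (A *ᵥ (E *ᵥ v)))
    (h1 : ∀ v, v ⬝ᵥ (A *ᵥ (E *ᵥ v)) ≤ x * (v ⬝ᵥ (A *ᵥ v)))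
    (hτ : ∀ v, v ⬝ᵥ (A *ᵥ v) ≤ τ * (v ⬝ᵥ (X *ᵥ v)))
    (hδ : δ * (1 - x ^ γ) = τ * x ^ γ) :
    IsApproxInv A X ((1 - E ^ γ) * A⁻¹) δ := by
  have hdet := (isUnit_iff_isUnit_det _).1 hA.isUnit
  have hxγ : x ^ γ < 1 := pow_lt_one₀ hx0.le hx1 hγ
  have hxγ0 : 0 < x ^ γ := pow_pos hx0 γ
  have hform : ∀ g, g ⬝ᵥ (((1 - E ^ γ) * A⁻¹) *ᵥ g) = g ⬝ᵥ (A⁻¹ *ᵥ g) -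
      (A⁻¹ *ᵥ g) ⬝ᵥ (A *ᵥ (E ^ γ *ᵥ (A⁻¹ *ᵥ g))) := fun g => by
    rw [Matrix.sub_mul, Matrix.one_mul, sub_mulVec, dotProduct_sub, ← mulVec_mulVec,
      mulVec_dotProduct_eq A⁻¹, hA.inv.transpose_eq, hA.inv_mulVec_mulVec]
  have hAinv : ∀ g, (A⁻¹ *ᵥ g) ⬝ᵥ (A *ᵥ (A⁻¹ *ᵥ g)) = g ⬝ᵥ (A⁻¹ *ᵥ g) := fun g => by
    rw [hA.mulVec_inv_mulVec, dotProduct_comm]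
  refine ⟨?_, fun g => ?_, fun g y => ?_⟩
  · have e : (1 - E ^ γ) * A⁻¹ = A⁻¹ - A⁻¹ * (A * E ^ γ) * A⁻¹ := by
      rw [← Matrix.mul_assoc, nonsing_inv_mul _ hdet, Matrix.one_mul, Matrix.sub_mul,
        Matrix.one_mul]
    rw [e, transpose_sub, transpose_mul, transpose_mul, hA.inv.transpose_eq,
      mul_pow_transpose hA.transpose_eq hsymm, Matrix.mul_assoc A⁻¹]
  · rw [hform]
    linarith [(form_pow_mem hsymm hx0 hA h0 h1 γ (A⁻¹ *ᵥ g)).1]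
  · rw [hform]
    have h2 := (form_pow_mem hsymm hx0 hA h0 h1 γ (A⁻¹ *ᵥ g)).2
    rw [hAinv] at h2
    have h3 := two_mul_dotProduct_sub_le hA g ((1 - x ^ γ)⁻¹ • y)
    simp only [mulVec_smul, dotProduct_smul, smul_dotProduct, smul_eq_mul] at h3
    have hd : 0 < 1 - x ^ γ := by linarith
    have h4 := mul_le_mul_of_nonneg_left h3 hd.le
    have e1 : (1 - x ^ γ) * (2 * ((1 - x ^ γ)⁻¹ * (g ⬝ᵥ y)) -
        (1 - x ^ γ)⁻¹ * ((1 - x ^ γ)⁻¹ * (y ⬝ᵥ (A *ᵥ y)))) =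
        2 * (g ⬝ᵥ y) - y ⬝ᵥ (A *ᵥ y) / (1 - x ^ γ) := by field_simp
    have h5 : y ⬝ᵥ (A *ᵥ y) / (1 - x ^ γ) ≤ y ⬝ᵥ (A *ᵥ y) + δ * (y ⬝ᵥ (X *ᵥ y)) := by
      rw [div_le_iff₀ hd]
      have h6 := mul_le_mul_of_nonneg_left (hτ y) hxγ0.le
      have e2 : δ * (y ⬝ᵥ (X *ᵥ y)) * (1 - x ^ γ) = x ^ γ * (τ * (y ⬝ᵥ (X *ᵥ y))) := by
        linear_combination (y ⬝ᵥ (X *ᵥ y)) * hδ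
      linarith
    linarith

end TwoGrid

/-! ### Convergence factors as bounds for quadratic forms -/

section EnergyNorm

variable {m : Type*} [Fintype m] {A B : Matrix m m ℝ}

theorem energyNorm_sq (hA : A.PosDef) (v : m → ℝ) : energyNorm A v ^ 2 = v ⬝ᵥ (A *ᵥ v) := by
  rw [energyNorm, dotProduct_comm, Real.sq_sqrt (hA.posSemidef.form_nonneg v)]

theorem energyNorm_nonneg (A : Matrix m m ℝ) (v : m → ℝ) : 0 ≤ energyNorm A v :=
  Real.sqrt_nonneg _

theorem energyNorm_mulVec_le (hA : A.PosDef) {x : ℝ} (hx : 0 ≤ x) {v : m → ℝ}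
    (h : (B *ᵥ v) ⬝ᵥ (A *ᵥ (B *ᵥ v)) ≤ x ^ 2 * (v ⬝ᵥ (A *ᵥ v))) :
    energyNorm A (B *ᵥ v) ≤ x * energyNorm A v := by
  refine (sq_le_sq₀ (energyNorm_nonneg A _) (mul_nonneg hx (energyNorm_nonneg A _))).1 ?_
  rwa [mul_pow, energyNorm_sq hA, energyNorm_sq hA]

theorem energyOpNorm_le (hA : A.PosDef) {x : ℝ} (hx : 0 ≤ x)
    (h : ∀ v, (B *ᵥ v) ⬝ᵥ (A *ᵥ (B *ᵥ v)) ≤ x ^ 2 * (v ⬝ᵥ (A *ᵥ v))) :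
    energyOpNorm A B ≤ x := by
  refine Real.sSup_le ?_ hx
  rintro _ ⟨v, -, rfl⟩
  exact div_le_of_le_mul₀ (energyNorm_nonneg A _) hx (energyNorm_mulVec_le hA hx (h v))

/-- The a priori bound `c` makes the set of quotients in `energyOpNorm` bounded, so that its
supremum is not a junk value. -/
theorem form_le_of_energyOpNorm_le (hA : A.PosDef) {c σ : ℝ} (hc : 0 ≤ c) (hσ : 0 < σ)
    (hB : ∀ v, (B *ᵥ v) ⬝ᵥ (A *ᵥ (B *ᵥ v)) ≤ c ^ 2 * (v ⬝ᵥ (A *ᵥ v)))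
    (h : energyOpNorm A B ≤ σ) (v : m → ℝ) :
    v ⬝ᵥ (A *ᵥ (B *ᵥ v)) ≤ σ * (v ⬝ᵥ (A *ᵥ v)) := by
  rcases eq_or_ne v 0 with rfl | hv
  · simp
  have hpos : 0 < energyNorm A v :=
    Real.sqrt_pos.2 (by rw [dotProduct_comm]; exact hA.form_pos hv)
  have hbdd : BddAbove {r : ℝ | ∃ v : m → ℝ, v ≠ 0 ∧
      r = energyNorm A (B *ᵥ v) / energyNorm A v} := by
    refine ⟨c, ?_⟩
    rintro _ ⟨u, -, rfl⟩
    exact div_le_of_le_mul₀ (energyNorm_nonneg A _) hc (energyNorm_mulVec_le hA hc (hB u))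
  have h1 : energyNorm A (B *ᵥ v) ≤ σ * energyNorm A v := by
    rw [← div_le_iff₀ hpos]
    exact (le_csSup hbdd ⟨v, hv, rfl⟩).trans h
  have h2 : (B *ᵥ v) ⬝ᵥ (A *ᵥ (B *ᵥ v)) ≤ σ ^ 2 * (v ⬝ᵥ (A *ᵥ v)) := by
    have h3 := pow_le_pow_left₀ (energyNorm_nonneg A _) h1 2
    rwa [mul_pow, energyNorm_sq hA, energyNorm_sq hA] at h3
  have h4 := two_mul_form_sub_le hA.posSemidef (B *ᵥ v) (σ • v)
  simp only [mulVec_smul, dotProduct_smul, smul_dotProduct, smul_eq_mul] at h4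
  rw [dotProduct_mulVec_comm_of_symm hA.transpose_eq (B *ᵥ v) v] at h4
  refine le_of_mul_le_mul_left ?_ hσ
  linarith [sq σ, mul_assoc σ σ (v ⬝ᵥ (A *ᵥ v))]

end EnergyNorm

/-! ### Roots of the bounding equation -/

section Roots

variable {σ τ ε : ℝ}

/-- On `(0, 1)` the denominator in `rootFun` does not vanish, so that its roots are those of the
numerator. -/
theorem rootFun_eq_zero_iff (hε : 0 < ε) (hτ : 0 < τ) (hσ : σ < 1) {γ : ℕ} (hγ : γ ≠ 0) {x : ℝ}
    (hx0 : 0 < x) (hx1 : x < 1) :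
    rootFun σ τ ε γ x = 0 ↔
      (σ - x) * ε * (1 - x ^ γ) + τ * (1 - σ) * (1 - ε - x) * x ^ γ = 0 := by
  have h1 : 0 < 1 - x ^ γ := sub_pos.2 (pow_lt_one₀ hx0.le hx1 hγ)
  have h2 : 0 < 1 - σ := sub_pos.2 hσ
  have hD : 0 < ε * (1 - x ^ γ) + τ * (1 - σ) * x ^ γ := by positivity
  rw [rootFun, sub_eq_zero, div_eq_iff hD.ne', ← sub_eq_zero]
  ring_nf

/-- The least root in `[σ, 1 - ε]` decreases strictly with `γ`, because the numerator of `rootFun`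
does; and `(x - σ) ε` is at most a multiple of `x ^ γ ≤ (1 - ε) ^ γ` at each root `x`, whence the
limit. -/
theorem exists_root_sequence (hε : 0 < ε) (hτ : 0 < τ) (hσ : 0 < σ) (hσε : σ < 1 - ε) :
    ∃ x : ℕ → ℝ, StrictAntiOn x (Set.Ici 1) ∧
      (∀ γ, 1 ≤ γ → x γ ∈ Set.Ioo σ (1 - ε) ∧ rootFun σ τ ε γ (x γ) = 0) ∧
      Filter.Tendsto x Filter.atTop (nhds σ) := by
  set g : ℕ → ℝ → ℝ := fun γ x =>
    (σ - x) * ε * (1 - x ^ γ) + τ * (1 - σ) * (1 - ε - x) * x ^ γ with hg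
  have hσ1 : 0 < 1 - σ := by linarith
  have hcont : ∀ γ, Continuous (g γ) := fun γ => by fun_prop
  have hgσ : ∀ γ, 0 < g γ σ := fun γ => by
    have : 0 < 1 - ε - σ := by linarith
    simp only [hg, sub_self, zero_mul, zero_add]
    positivity
  have hroot : ∀ γ y, σ < y → g γ y < 0 → ∃ z ∈ Set.Ioo σ y, g γ z = 0 := fun γ y hy hgy => by
    obtain ⟨z, hz, hz'⟩ := intermediate_value_Ioo' hy.le (hcont γ).continuousOn ⟨hgy, hgσ γ⟩
    exact ⟨z, hz, hz'⟩
  have hend : ∀ γ, 1 ≤ γ → g γ (1 - ε) < 0 := fun γ hγ => by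
    have h1 : (1 - ε) ^ γ < 1 := pow_lt_one₀ (by linarith) (by linarith) (by omega)
    have h2 := mul_pos (mul_pos (show 0 < 1 - ε - σ by linarith) hε) (sub_pos.2 h1)
    simp only [hg, sub_self, mul_zero, zero_mul, add_zero]
    linarith
  have hleast : ∀ γ, ∃ x, 1 ≤ γ → IsLeast {x ∈ Set.Icc σ (1 - ε) | g γ x = 0} x := fun γ => by
    by_cases hγ : 1 ≤ γ
    · have hcpt : IsCompact {x ∈ Set.Icc σ (1 - ε) | g γ x = 0} :=
        isCompact_Icc.inter_right (isClosed_eq (hcont γ) continuous_const)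
      obtain ⟨z, hz, hz'⟩ := hroot γ _ hσε (hend γ hγ)
      obtain ⟨x, hx⟩ := hcpt.exists_isLeast ⟨z, ⟨hz.1.le, hz.2.le⟩, hz'⟩
      exact ⟨x, fun _ => hx⟩
    · exact ⟨0, fun h => absurd h hγ⟩
  choose x hx using hleast
  have hmem : ∀ γ, 1 ≤ γ → x γ ∈ Set.Ioo σ (1 - ε) := fun γ hγ => by
    obtain ⟨⟨h1, h2⟩, h3⟩ := (hx γ hγ).1
    refine ⟨lt_of_le_of_ne h1 ?_, lt_of_le_of_ne h2 ?_⟩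
    · intro h; exact (hgσ γ).ne' (h ▸ h3)
    · intro h; exact (hend γ hγ).ne (h ▸ h3)
  refine ⟨x, fun γ hγ γ' hγ' hlt => ?_, fun γ hγ => ⟨hmem γ hγ, ?_⟩, ?_⟩
  · obtain ⟨h1, h2⟩ := hmem γ hγ
    have hpow : x γ ^ γ' < x γ ^ γ :=
      pow_lt_pow_right_of_lt_one₀ (hσ.trans h1) (by linarith) hlt
    have hbr : 0 < (x γ - σ) * ε + τ * (1 - σ) * (1 - ε - x γ) := by
      have := sub_pos.2 h1
      have := sub_pos.2 h2
      positivity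
    have hneg : g γ' (x γ) < 0 := by
      have h0 : g γ (x γ) = 0 := (hx γ hγ).1.2
      have := mul_lt_mul_of_pos_left hpow hbr
      simp only [hg] at h0 ⊢
      linarith
    obtain ⟨z, hz, hz'⟩ := hroot γ' _ h1 hneg
    exact ((hx γ' hγ').2 ⟨⟨hz.1.le, (hz.2.trans h2).le⟩, hz'⟩).trans_lt hz.2
  · obtain ⟨h1, h2⟩ := hmem γ hγ
    exact (rootFun_eq_zero_iff hε hτ (by linarith) (by omega) (hσ.trans h1) (by linarith)).2
      (hx γ hγ).1.2
  · set C := ((1 - ε - σ) * ε + τ * (1 - σ) * (1 - ε - σ)) / ε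
    have hlim : Filter.Tendsto (fun γ : ℕ => σ + C * (1 - ε) ^ γ) Filter.atTop (nhds σ) := by
      have h := (tendsto_pow_atTop_nhds_zero_of_lt_one (r := 1 - ε) (by linarith)
        (by linarith)).const_mul C |>.const_add σ
      simpa using h
    refine tendsto_of_tendsto_of_tendsto_of_le_of_le' tendsto_const_nhds hlim ?_ ?_
    · filter_upwards [Filter.eventually_ge_atTop 1] with γ hγ using (hmem γ hγ).1.le
    · filter_upwards [Filter.eventually_ge_atTop 1] with γ hγ
      obtain ⟨h1, h2⟩ := hmem γ hγ
      have h0 : g γ (x γ) = 0 := (hx γ hγ).1.2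
      have hx0 : 0 ≤ x γ := (hσ.trans h1).le
      have hbr : (x γ - σ) * ε + τ * (1 - σ) * (1 - ε - x γ) ≤
          (1 - ε - σ) * ε + τ * (1 - σ) * (1 - ε - σ) := by
        gcongr
      have hbr0 : 0 ≤ (1 - ε - σ) * ε + τ * (1 - σ) * (1 - ε - σ) := by
        have := sub_pos.2 hσε
        positivity
      have h3 := mul_le_mul hbr (pow_le_pow_left₀ hx0 h2.le γ) (pow_nonneg hx0 γ) hbr0
      have h4 : x γ - σ ≤ C * (1 - ε) ^ γ := by
        rw [div_mul_eq_mul_div, le_div_iff₀ hε]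
        simp only [hg] at h0
        linarith
      linarith

end Roots

/-! ### The multigrid hierarchy -/

namespace Hierarchy

variable {L : ℕ} (H : Hierarchy L)

theorem n_pos {k : ℕ} (hk : k ≤ L) : 0 < H.n k := by
  induction k with
  | zero => exact H.n_zero_pos
  | succ k ih => exact (ih (by omega)).trans (H.n_lt k (by omega))

theorem nonempty_index {k : ℕ} (hk : k ≤ L) : Nonempty (Fin (H.n k)) :=
  ⟨⟨0, H.n_pos hk⟩⟩

theorem injective_P {k : ℕ} (hk : k < L) : Function.Injective (H.P k).mulVec := by
  rw [mulVec_injective_iff, linearIndependent_iff_card_eq_finrank_span, Fintype.card_fin]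
  exact (H.rank_P k hk).symm.trans (rank_eq_finrank_span_cols _)

theorem A_posDef {k : ℕ} (hk : k ≤ L) : (H.A k).PosDef := by
  induction hk using Nat.decreasingInduction with
  | self => exact H.posDef
  | of_succ k hk ih =>
    rw [H.galerkin k hk]
    have h := ih.conjTranspose_mul_mul_same (H.injective_P hk)
    rwa [conjTranspose_eq_transpose_of_trivial] at h

theorem Mtilde_posDef {k : ℕ} (hk : k < L) : (H.Mtilde (k + 1)).PosDef :=
  symmSmoother_posDef (H.isUnit_M k hk) (H.smoother k hk)

theorem restrictedSmoother_posDef {k : ℕ} (hk : k < L) : (H.restrictedSmoother k).PosDef := by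
  have h := (H.Mtilde_posDef hk).conjTranspose_mul_mul_same (H.injective_P hk)
  rwa [conjTranspose_eq_transpose_of_trivial] at h

theorem epsL_pos (hL : 1 ≤ L) : 0 < H.epsL := by
  have : Nonempty (Fin L) := ⟨⟨0, hL⟩⟩
  obtain ⟨k, hk⟩ := exists_eq_ciInf_of_finite
    (f := fun k : Fin L => lamMin ((H.Mtilde (k + 1))⁻¹ * H.A (k + 1)))
  have : Nonempty (Fin (H.n (k + 1))) := H.nonempty_index k.2
  rw [epsL, ← hk]
  exact lamMin_pos (H.Mtilde_posDef k.2) (H.A_posDef k.2)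

theorem tauL_pos (hL : 1 ≤ L) : 0 < H.tauL := by
  have : Nonempty (Fin L) := ⟨⟨0, hL⟩⟩
  obtain ⟨k, hk⟩ := exists_eq_ciSup_of_finite
    (f := fun k : Fin L => lamMax ((H.restrictedSmoother k)⁻¹ * H.A k))
  have : Nonempty (Fin (H.n k)) := H.nonempty_index k.2.le
  rw [tauL, ← hk]
  exact lamMax_pos (H.restrictedSmoother_posDef k.2) (H.A_posDef k.2.le)

theorem epsL_mul_form_le {k : ℕ} (hk : k < L) (v : Fin (H.n (k + 1)) → ℝ) :
    H.epsL * (v ⬝ᵥ (H.Mtilde (k + 1) *ᵥ v)) ≤ v ⬝ᵥ (H.A (k + 1) *ᵥ v) := by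
  have : Nonempty (Fin (H.n (k + 1))) := H.nonempty_index hk
  have hX := H.Mtilde_posDef hk
  refine le_trans (mul_le_mul_of_nonneg_right ?_ (hX.posSemidef.form_nonneg v))
    (lamMin_mul_le_form hX (H.A_posDef hk).transpose_eq v)
  exact ciInf_le (f := fun k : Fin L => lamMin ((H.Mtilde (k + 1))⁻¹ * H.A (k + 1)))
    (Set.finite_range _).bddBelow ⟨k, hk⟩

theorem form_le_tauL_mul {k : ℕ} (hk : k < L) (v : Fin (H.n k) → ℝ) :
    v ⬝ᵥ (H.A k *ᵥ v) ≤ H.tauL * (v ⬝ᵥ (H.restrictedSmoother k *ᵥ v)) := by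
  have : Nonempty (Fin (H.n k)) := H.nonempty_index hk.le
  have hX := H.restrictedSmoother_posDef hk
  refine (form_le_lamMax_mul hX (H.A_posDef hk.le).transpose_eq v).trans
    (mul_le_mul_of_nonneg_right ?_ (hX.posSemidef.form_nonneg v))
  exact le_ciSup (f := fun k : Fin L => lamMax ((H.restrictedSmoother k)⁻¹ * H.A k))
    (Set.finite_range _).bddAbove ⟨k, hk⟩

theorem ETG_form_le (hσ : 0 < H.sigmaL) (hε0 : 0 < H.epsL) (hε1 : H.epsL < 1)
    {k : ℕ} (hk : k < L) (v : Fin (H.n (k + 1)) → ℝ) :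
    v ⬝ᵥ (H.A (k + 1) *ᵥ (twoGridIter (H.A (k + 1)) (H.M (k + 1)) (H.P k) (H.A k)⁻¹ *ᵥ v)) ≤
      H.sigmaL * (v ⬝ᵥ (H.A (k + 1) *ᵥ v)) := by
  have hA := H.A_posDef hk
  have hAc := H.A_posDef hk.le
  have hle : H.sigmaTG k ≤ H.sigmaL :=
    le_ciSup (f := fun k : Fin L => H.sigmaTG k) (Set.finite_range _).bddAbove ⟨k, hk⟩
  rw [sigmaTG, ETG, ← H.galerkin k hk] at hle
  refine form_le_of_energyOpNorm_le hA (c := 1 - H.epsL) (by linarith) hσ (fun u => ?_) hle v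
  refine form_mulVec_le
    (mul_twoGridIter_transpose hA.transpose_eq hAc.inv.transpose_eq) (by linarith)
    (fun u => ?_) (fun u => ?_) u
  · exact twoGridIter_form_nonneg hA hAc (H.galerkin k hk) (fun g => le_rfl) u
  · exact (twoGridIter_form_le_smooth hA.transpose_eq
      (fun g => hAc.inv.posSemidef.form_nonneg g) u).trans
      (smooth_le hA (H.isUnit_M k hk) (H.smoother k hk) hε0 hε1 (H.epsL_mul_form_le hk) u)

theorem isApproxInv_coarsest (hL : 1 ≤ L) {Ahat : Matrix (Fin (H.n 0)) (Fin (H.n 0)) ℝ}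
    (hAhat : (Ahat - H.A 0).PosSemidef) {δ : ℝ}
    (hspec : spectrum ℝ ((H.restrictedSmoother 0)⁻¹ * (Ahat - H.A 0)) ⊆ Set.Icc 0 δ) :
    IsApproxInv (H.A 0) (H.restrictedSmoother 0) Ahat⁻¹ δ := by
  have : Nonempty (Fin (H.n 0)) := H.nonempty_index (Nat.zero_le L)
  have hA := H.A_posDef (Nat.zero_le L)
  have hX := H.restrictedSmoother_posDef (show 0 < L from hL)
  have hB : Ahat.PosDef := by simpa using hA.add_posSemidef hAhat
  obtain ⟨μ, hμ, hle⟩ := exists_mem_spectrum_form_le hX hAhat.transpose_eq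
  refine ⟨hB.inv.transpose_eq, fun g => ?_, fun g y => ?_⟩
  · have h1 := two_mul_dotProduct_sub_le hA g (Ahat⁻¹ *ᵥ g)
    have h2 := hAhat.form_nonneg (Ahat⁻¹ *ᵥ g)
    rw [sub_mulVec, dotProduct_sub, hB.mulVec_inv_mulVec, dotProduct_comm _ g] at h2
    linarith
  · have h1 := two_mul_dotProduct_sub_le hB g y
    have h2 := hle y
    rw [sub_mulVec, dotProduct_sub] at h2
    have h3 := mul_le_mul_of_nonneg_right (hspec hμ).2 (hX.posSemidef.form_nonneg y)
    linarith

/-- If `x` is a root of `rootFun` in `(σ_L, 1 - ε_L)`, the quality `δ` allowed for the coarsest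
solver is reproduced on every level, and with it the bound `x` for the error form. -/
theorem sigmaIMG_le (hL : 1 ≤ L) (hσ_pos : 0 < H.sigmaL) (hσ_lt : H.sigmaL < 1 - H.epsL)
    {γ : ℕ} (hγ : 1 ≤ γ) {x : ℝ} (hx : x ∈ Set.Ioo H.sigmaL (1 - H.epsL))
    (hroot : rootFun H.sigmaL H.tauL H.epsL γ x = 0)
    {Ahat : Matrix (Fin (H.n 0)) (Fin (H.n 0)) ℝ} (hAhat : (Ahat - H.A 0).PosSemidef)
    (hspec : spectrum ℝ ((H.restrictedSmoother 0)⁻¹ * (Ahat - H.A 0)) ⊆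
      Set.Icc 0 (H.epsL * (x - H.sigmaL) / ((1 - H.sigmaL) * (1 - H.epsL - x)))) :
    ∀ k < L, H.sigmaIMG Ahat γ k ≤ x := by
  have hε := H.epsL_pos hL
  have hτ := H.tauL_pos hL
  have hσ1 : H.sigmaL < 1 := by linarith
  have hε1 : H.epsL < 1 := by linarith
  have hx0 : 0 < x := hσ_pos.trans hx.1
  have hx1 : x < 1 := by linarith [hx.2]
  have hγ0 : γ ≠ 0 := by omega
  have hd1 : 0 < 1 - H.sigmaL := sub_pos.2 hσ1
  have hd2 : 0 < 1 - H.epsL - x := sub_pos.2 hx.2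
  rw [rootFun_eq_zero_iff hε hτ hσ1 hγ0 hx0 hx1] at hroot
  set δ := H.epsL * (x - H.sigmaL) / ((1 - H.sigmaL) * (1 - H.epsL - x)) with hδdef
  have hδ0 : 0 ≤ δ := div_nonneg (mul_nonneg hε.le (sub_nonneg.2 hx.1.le)) (by positivity)
  have hδ : δ * ((1 - H.sigmaL) * (1 - H.epsL - x)) = H.epsL * (x - H.sigmaL) :=
    div_mul_cancel₀ _ (by positivity)
  -- The equation for `x` says that the coarse solvers of all levels share the quality `δ`.
  have hδγ : δ * (1 - x ^ γ) = H.tauL * x ^ γ := by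
    refine mul_right_cancel₀ (mul_pos hd1 hd2).ne' ?_
    linear_combination (1 - x ^ γ) * hδ - hroot
  have step : ∀ k, k < L →
      IsApproxInv (H.A k) (H.restrictedSmoother k) (H.coarseSolve Ahat γ k) δ →
      (H.A (k + 1) * H.EIMG Ahat γ k)ᵀ = H.A (k + 1) * H.EIMG Ahat γ k ∧
      (∀ v, 0 ≤ v ⬝ᵥ (H.A (k + 1) *ᵥ (H.EIMG Ahat γ k *ᵥ v))) ∧
      ∀ v, v ⬝ᵥ (H.A (k + 1) *ᵥ (H.EIMG Ahat γ k *ᵥ v)) ≤ x * (v ⬝ᵥ (H.A (k + 1) *ᵥ v)) :=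
    fun k hk hS => by
      have hA := H.A_posDef hk
      have hAc := H.A_posDef hk.le
      exact ⟨mul_twoGridIter_transpose hA.transpose_eq hS.symm,
        twoGridIter_form_nonneg hA hAc (H.galerkin k hk) hS.form_le,
        twoGridIter_form_le hA (H.isUnit_M k hk) (H.smoother k hk) hAc (H.galerkin k hk) hδ0 hS
          hσ1 hε hε1 hx1 (H.ETG_form_le hσ_pos hε hε1 hk) (H.epsL_mul_form_le hk) hδ⟩
  have happrox : ∀ k, k < L →
      IsApproxInv (H.A k) (H.restrictedSmoother k) (H.coarseSolve Ahat γ k) δ := by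
    intro k
    induction k with
    | zero => exact fun _ => H.isApproxInv_coarsest hL hAhat hspec
    | succ k ih =>
      intro hk
      obtain ⟨h1, h2, h3⟩ := step k (by omega) (ih (by omega))
      exact isApproxInv_iterate (H.A_posDef hk.le) h1 hx0 hx1 hγ0 h2 h3
        (H.form_le_tauL_mul hk) hδγ
  intro k hk
  obtain ⟨h1, h2, h3⟩ := step k hk (happrox k hk)
  exact energyOpNorm_le (H.A_posDef hk) hx0.le (form_mulVec_le h1 hx0 h2 h3)

end Hierarchy

end Multigrid

theorem theorem4p2 (L : ℕ) (hL : 1 ≤ L) (H : Multigrid.Hierarchy L)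
    (hσ_pos : 0 < H.sigmaL) (hσ_lt : H.sigmaL < 1 - H.epsL) :
    (∃ x : ℕ → ℝ, StrictAntiOn x (Set.Ici 1) ∧
      (∀ γ, 1 ≤ γ → x γ ∈ Set.Ioo H.sigmaL (1 - H.epsL) ∧
        Multigrid.rootFun H.sigmaL H.tauL H.epsL γ (x γ) = 0) ∧
      Filter.Tendsto x Filter.atTop (nhds H.sigmaL)) ∧
    ∀ (γ : ℕ), 1 ≤ γ → ∀ (x : ℝ), x ∈ Set.Ioo H.sigmaL (1 - H.epsL) →
      Multigrid.rootFun H.sigmaL H.tauL H.epsL γ x = 0 →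
      ∀ Ahat : Matrix (Fin (H.n 0)) (Fin (H.n 0)) ℝ, (Ahat - H.A 0).PosSemidef →
        spectrum ℝ ((H.restrictedSmoother 0)⁻¹ * (Ahat - H.A 0)) ⊆
          Set.Icc 0 (H.epsL * (x - H.sigmaL) / ((1 - H.sigmaL) * (1 - H.epsL - x))) →
        ∀ k < L, H.sigmaIMG Ahat γ k ≤ x := by
  refine ⟨Multigrid.exists_root_sequence (H.epsL_pos hL) (H.tauL_pos hL) hσ_pos hσ_lt, ?_⟩
  intro γ hγ x hx hroot Ahat hAhat hspec
  exact H.sigmaIMG_le hL hσ_pos hσ_lt hγ hx hroot hAhat hspec
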